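/- Let $E\subset\mathbb{R}^{n+1}$ be a non-empty bounded set satisfying the uniform ball condition with some radius $r>0$: for every $x\in\partial E$ there are open balls $B_r(x_+)\subset\mathbb{R}^{n+1}\setminus E$ and $B_r(x_-)\subset E$ with $x\in\partial B_r(x_+)\cap\partial B_r(x_-)$. Let $\nu_E$ be the outer unit normal on $\partial E$, let $r_E$ be the supremum of all radii for which $E$ satisfies the uniform ball condition, and let $$S_E(x,y)=\frac{(x-y)\cdot\nu_E(x)}{|x-y|^2},\qquad \|S_E\|_{L^\infty}=\sup\{|S_E(x,y)|: x,y\in\partial E,\ x\ne y\}.$$ Then $\nu_E$ exists at every point of $\partial E$, $r_E$ and $\|S_E\|_{L^\infty}$ are finite, and $r_E=\sup\{r>0: d_E \text{ is differentiable in } \{z:\operatorname{dist}(z,\partial E)<r\}\}$, where $d_E$ is the signed distance function of $E$ (equal to $\operatorname{dist}(x,E)$ for $x\notin E$ and to $-\operatorname{dist}(x,\mathbb{R}^{n+1}\setminus E)$ for $x\in E$). Moreover $$2\|S_E\|_{L^\infty}=\frac1{r_E}\qquad\text{and}\qquad \frac{|\nu_E(x)-\nu_E(y)|}{|x-y|}\le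 2\|S_E\|_{L^\infty}\quad\text{for all } x,y\in\partial E,\ x\neq y.$$ If in addition $E$ is $C^2$-regular (near every boundary point, in suitable orthonormal coordinates, the interior of $E$ is the strict subgraph of a $C^2$ function), then $\nu_E$ is differentiable along $\partial E$ and the second fundamental form $B_E=\nabla_\tau\nu_E$ (the tangential differential of $\nu_E$, extended by zero in the normal direction) and the mean curvature $H_E=\operatorname{Tr}B_E$ satisfy $$|H_E|\le 2n\|S_E\|_{L^\infty}\quad\text{and}\quad |B_E|\le 2n\|S_E\|_{L^\infty}\qquad\text{on }\partial E,$$ where $|B_E|=\sqrt{\operatorname{Tr}(B_E^{T}B_E)}$ is the Frobenius norm. -/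

import Mathlib

noncomputable section

namespace BallCond

/-- The Euclidean space of dimension `n + 1`. -/
abbrev Space (n : ℕ) : Type := EuclideanSpace ℝ (Fin (n + 1))

/-- Uniform ball condition with radius `r`: every boundary point of `E` lies on the boundary of an
open ball of radius `r` outside `E` and of an open ball of radius `r` inside `E`. -/
def UniformBall {n : ℕ} (E : Set (Space n)) (r : ℝ) : Prop :=
  0 < r ∧ ∀ x ∈ frontier E, ∃ p q : Space n,
    Metric.ball p r ⊆ Eᶜ ∧ Metric.ball q r ⊆ E ∧ x ∈ Metric.sphere p r ∧ x ∈ Metric.sphere q r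

/-- The supremum `r_E` of the radii of the uniform ball condition. -/
def maxRadius {n : ℕ} (E : Set (Space n)) : ℝ :=
  sSup {r : ℝ | UniformBall E r}

open Classical in
/-- The signed distance function of `E`: positive outside `E`, negative inside. -/
def signedDist {n : ℕ} (E : Set (Space n)) (x : Space n) : ℝ :=
  if x ∈ E then -Metric.infDist x Eᶜ else Metric.infDist x E

/-- The radii `r > 0` such that the signed distance function is differentiable in the open
`r`-neighbourhood of the boundary. -/
def diffRadii {n : ℕ} (E : Set (Space n)) : Set ℝ :=
  {r : ℝ | 0 < r ∧ DifferentiableOn ℝ (signedDist E) (Metric.thickening r (frontier E))}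

/-- `ν` is an outer unit normal of `E` at `x`: it has length one, and close to `x` the complement
of `E` contains every cone `{y | ⟪y - x, ν⟫ > ε |y - x|}` and `E` contains every opposite cone.
Such a vector is unique; where the boundary is locally the graph of a differentiable function it is
the usual outer unit normal. -/
def IsOuterUnitNormal {n : ℕ} (E : Set (Space n)) (x ν : Space n) : Prop :=
  ‖ν‖ = 1 ∧ ∀ ε > (0 : ℝ), ∃ δ > (0 : ℝ), ∀ y : Space n, ‖y - x‖ < δ →
    (ε * ‖y - x‖ < inner ℝ (y - x) ν → y ∉ E) ∧
    (inner ℝ (y - x) ν < -(ε * ‖y - x‖) → y ∈ E)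

open Classical in
/-- The outer unit normal field `ν_E` (zero at points which have no outer unit normal). -/
def normal {n : ℕ} (E : Set (Space n)) (x : Space n) : Space n :=
  if h : ∃ ν : Space n, IsOuterUnitNormal E x ν then h.choose else 0

/-- The two-point function `S_E (x, y) = (x - y) · ν_E(x) / |x - y| ^ 2`. -/
def twoPoint {n : ℕ} (E : Set (Space n)) (x y : Space n) : ℝ :=
  inner ℝ (x - y) (normal E x) / ‖x - y‖ ^ 2

/-- The values `|S_E (x, y)|` for distinct boundary points `x`, `y`. -/
def twoPointValues {n : ℕ} (E : Set (Space n)) : Set ℝ :=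
  {s : ℝ | ∃ x ∈ frontier E, ∃ y ∈ frontier E, x ≠ y ∧ s = |twoPoint E x y|}

/-- The supremum norm of the two-point function. -/
def twoPointNorm {n : ℕ} (E : Set (Space n)) : ℝ :=
  sSup (twoPointValues E)

/-- `E` is `C^k`-regular: around every boundary point `x`, in suitable orthonormal coordinates
centred at `x`, the interior of `E` is, in an open cylinder centred at `x`, the strict subgraph of a
`C^k` function whose graph does not leave the cylinder through its top or bottom. -/
def IsRegular {n : ℕ} (k : ℕ) (E : Set (Space n)) : Prop :=
  ∀ x ∈ frontier E, ∃ Φ : Space n ≃ₗᵢ[ℝ] WithLp 2 (EuclideanSpace ℝ (Fin n) × ℝ),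
    ∃ ρ > (0 : ℝ), ∃ R > (0 : ℝ), ∃ f : EuclideanSpace ℝ (Fin n) → ℝ,
      ContDiffOn ℝ k f (Metric.ball 0 ρ) ∧
      (∀ u ∈ Metric.ball (0 : EuclideanSpace ℝ (Fin n)) ρ, |f u| < R) ∧
      ∀ y : Space n, ‖(Φ (y - x)).fst‖ < ρ → |(Φ (y - x)).snd| < R →
        (y ∈ interior E ↔ (Φ (y - x)).snd < f (Φ (y - x)).fst)

/-- The orthogonal projection `P = I - ν_E ⊗ ν_E` onto the geometric tangent plane at `x`. -/
def tangentProj {n : ℕ} (E : Set (Space n)) (x : Space n) : Space n →L[ℝ] Space n :=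
  ContinuousLinearMap.id ℝ (Space n) - (innerSL ℝ (normal E x)).smulRight (normal E x)

/-- The second fundamental form `B_E`, the tangential differential of `ν_E` along the boundary:
a derivative of `ν_E` along the boundary composed with the projection `P`. (A derivative along the
boundary is determined on tangent vectors only; the composition with `P` does not depend on the
derivative chosen.) -/
def secondForm {n : ℕ} (E : Set (Space n)) (x : Space n) : Space n →L[ℝ] Space n :=
  (fderivWithin ℝ (normal E) (frontier E) x).comp (tangentProj E x)

/-- The mean curvature `H_E`, the trace of the second fundamental form. -/
def meanCurv {n : ℕ} (E : Set (Space n)) (x : Space n) : ℝ :=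
  LinearMap.trace ℝ (Space n) (secondForm E x : Space n →ₗ[ℝ] Space n)

/-- The Frobenius norm `√(Tr (Aᵀ A))`. -/
def frobenius {n : ℕ} (A : Space n →L[ℝ] Space n) : ℝ :=
  √(LinearMap.trace ℝ (Space n)
    (((ContinuousLinearMap.adjoint A).comp A : Space n →L[ℝ] Space n) : Space n →ₗ[ℝ] Space n))

end BallCond

end

/-!
If two balls of radius `r` touch `∂E` at `x` from outside and inside, their centres are
`x ± r ν_E(x)`, and no boundary point `y` lies in them: `2 r |(y - x) · ν_E(x)| ≤ |y - x| ^ 2`.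
Conversely, if this bound holds for a radius `r` and all pairs of boundary points, then the open
ball of radius `r` around `x + r ν_E(x)` does not meet `∂E`; being connected, it stays on the side
of `∂E` on which a small touching ball shows it to start. So `r_E` and `1 / (2 ‖S_E‖)` coincide.

The outer ball at `x` and the inner ball at `y` are disjoint, and so are the inner ball at `x` and
the outer ball at `y`. The parallelogram law applied to the two resulting inequalities between
centres is the Lipschitz estimate for the normal.

Between two touching balls the signed distance is squeezed between two smooth functions, hence
differentiable. Conversely, where the distance to `E` is differentiable its gradient is a unit
vector pointing away from the nearest point. A maximiser of the distance over a small ball around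
`z = x + R ν_E(x)` therefore lies at `z + h ν_E(x)`, with distance `R + h`: the outer ball of radius
`R` grows to radius `R + h`, as long as the distance is differentiable.

Every vector orthogonal to the normal belongs to the tangent cone of `∂E`, since a segment from the
inner to the outer cone crosses `∂E`. So the Lipschitz estimate bounds `B_E` on the tangent space.
-/

namespace BallCond

open Set Filter Topology Metric

section Topology

theorem subset_of_disjoint_frontier {X : Type*} [TopologicalSpace X] {s t : Set X}
    (hs : IsPreconnected s) (hd : Disjoint s (frontier t)) (hst : (s ∩ t).Nonempty) : s ⊆ t := by
  have hcover : s ⊆ interior t ∪ (closure t)ᶜ := fun y hy =>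
    or_iff_not_imp_right.2 fun hy' => by_contra fun hi => disjoint_left.1 hd hy ⟨not_not.1 hy', hi⟩
  obtain ⟨a, ha, hat⟩ := hst
  exact (hs.subset_left_of_subset_union isOpen_interior isClosed_closure.isOpen_compl
    (disjoint_compl_right_iff_subset.2 interior_subset_closure) hcover
    ⟨a, ha, (hcover ha).resolve_right fun h => h (subset_closure hat)⟩).trans interior_subset

theorem exists_mem_segment_mem_frontier {V : Type*} [AddCommGroup V] [Module ℝ V]
    [TopologicalSpace V] [ContinuousAdd V] [ContinuousSMul ℝ V] {s : Set V} {a b : V}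
    (ha : a ∈ s) (hb : b ∉ s) : ∃ w ∈ segment ℝ a b, w ∈ frontier s := by
  by_contra! h
  exact hb (subset_of_disjoint_frontier (convex_segment a b).isPreconnected (disjoint_left.2 h)
    ⟨a, left_mem_segment ℝ a b, ha⟩ (right_mem_segment ℝ a b))

end Topology

section InnerProductSpace

variable {V : Type*} [NormedAddCommGroup V] [InnerProductSpace ℝ V]

theorem mem_ball_add_smul_iff {x y ν : V} (hν : ‖ν‖ = 1) {r : ℝ} (hr : 0 < r) :
    y ∈ ball (x + r • ν) r ↔ ‖y - x‖ ^ 2 < 2 * r * inner ℝ (y - x) ν := by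
  have h : ‖y - (x + r • ν)‖ ^ 2 = ‖y - x‖ ^ 2 - 2 * (r * inner ℝ (y - x) ν) + r ^ 2 := by
    rw [← sub_sub, norm_sub_sq_real, inner_smul_right, norm_smul, hν, mul_one, Real.norm_eq_abs,
      sq_abs]
  rw [mem_ball, dist_eq_norm, ← sq_lt_sq₀ (norm_nonneg _) hr.le, h]
  constructor <;> intro <;> linarith

theorem mem_ball_sub_smul_iff {x y ν : V} (hν : ‖ν‖ = 1) {r : ℝ} (hr : 0 < r) :
    y ∈ ball (x - r • ν) r ↔ ‖y - x‖ ^ 2 < -(2 * r * inner ℝ (y - x) ν) := by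
  rw [sub_eq_add_neg, ← smul_neg, mem_ball_add_smul_iff (by rwa [norm_neg]) hr, inner_neg_right,
    mul_neg]

theorem eq_smul_of_le_inner {u v : V} (hu : ‖u‖ = 1) {t : ℝ} (hv : ‖v‖ ≤ t)
    (h : t ≤ inner ℝ v u) : v = t • u := by
  have h0 : ‖v - t • u‖ ^ 2 ≤ 0 := by
    rw [norm_sub_sq_real, inner_smul_right, norm_smul, hu, mul_one, Real.norm_eq_abs, sq_abs]
    nlinarith [norm_nonneg v]
  exact sub_eq_zero.1 (norm_eq_zero.1 (pow_eq_zero_iff two_ne_zero |>.1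
    (h0.antisymm (sq_nonneg _))))

theorem exists_eq_add_smul_eq_sub_smul {x p q : V} {r : ℝ} (hr : 0 < r)
    (hd : Disjoint (ball p r) (ball q r)) (hp : x ∈ sphere p r) (hq : x ∈ sphere q r) :
    ∃ ν : V, ‖ν‖ = 1 ∧ p = x + r • ν ∧ q = x - r • ν := by
  rw [mem_sphere] at hp hq
  have hpq : dist p q = r + r :=
    ((dist_triangle_left p q x).trans_eq (by rw [hp, hq])).antisymm
      ((disjoint_ball_ball_iff hr hr).1 hd)
  have hmid : x = midpoint ℝ p q :=
    eq_midpoint_of_dist_eq_half (by rw [dist_comm, hp]; linarith) (by rw [hq]; linarith)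
  have hadd : x + x = p + q := by rw [hmid, midpoint_add_self]
  refine ⟨r⁻¹ • (p - x), ?_, ?_, ?_⟩
  · rw [norm_smul, ← dist_eq_norm, dist_comm, hp, norm_inv, Real.norm_of_nonneg hr.le,
      inv_mul_cancel₀ hr.ne']
  · rw [smul_inv_smul₀ hr.ne', add_sub_cancel]
  · rw [smul_inv_smul₀ hr.ne', sub_sub_eq_add_sub, hadd, add_sub_cancel_left]

end InnerProductSpace

section OuterNormal

variable {n : ℕ} {E : Set (Space n)} {x v ν ν' : Space n}

theorem IsOuterUnitNormal.compl (h : IsOuterUnitNormal E x ν) : IsOuterUnitNormal Eᶜ x (-ν) := by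
  refine ⟨by rw [norm_neg, h.1], fun ε hε => ?_⟩
  obtain ⟨δ, hδ, H⟩ := h.2 ε hε
  refine ⟨δ, hδ, fun y hy => ?_⟩
  rw [inner_neg_right, notMem_compl_iff, mem_compl_iff, neg_lt_neg_iff]
  exact ⟨fun hlt => (H y hy).2 (lt_neg_of_lt_neg hlt), (H y hy).1⟩

theorem IsOuterUnitNormal.eventually_notMem (h : IsOuterUnitNormal E x ν)
    (hv : 0 < inner ℝ v ν) : ∀ᶠ t in 𝓝[>] (0 : ℝ), x + t • v ∉ E := by
  have hv0 : 0 < ‖v‖ := norm_pos_iff.2 fun h0 => by simp [h0] at hv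
  obtain ⟨δ, hδ, H⟩ := h.2 (inner ℝ v ν / (2 * ‖v‖)) (by positivity)
  filter_upwards [Ioo_mem_nhdsGT (show 0 < δ / ‖v‖ by positivity)] with t ht
  have hn : ‖x + t • v - x‖ = t * ‖v‖ := by
    rw [add_sub_cancel_left, norm_smul, Real.norm_of_nonneg ht.1.le]
  refine (H _ (hn ▸ (lt_div_iff₀ hv0).1 ht.2)).1 ?_
  rw [hn, add_sub_cancel_left, real_inner_smul_left]
  field_simp
  linarith [ht.1]

theorem IsOuterUnitNormal.eventually_mem (h : IsOuterUnitNormal E x ν)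
    (hv : inner ℝ v ν < 0) : ∀ᶠ t in 𝓝[>] (0 : ℝ), x + t • v ∈ E :=
  (h.compl.eventually_notMem (by rwa [inner_neg_right, neg_pos])).mono fun _ => notMem_compl_iff.1

theorem IsOuterUnitNormal.eq (h : IsOuterUnitNormal E x ν) (h' : IsOuterUnitNormal E x ν') :
    ν = ν' := by
  by_contra hne
  have hlt : inner ℝ ν ν' < 1 := (inner_lt_one_iff_real_of_norm_eq_one h.1 h'.1).2 hne
  have hν : 0 < inner ℝ (ν - ν') ν := by
    rw [inner_sub_left, real_inner_self_eq_norm_sq, h.1, real_inner_comm]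
    linarith
  have hν' : inner ℝ (ν - ν') ν' < 0 := by
    rw [inner_sub_left, real_inner_self_eq_norm_sq, h'.1]
    linarith
  obtain ⟨t, ht, ht'⟩ := ((h.eventually_notMem hν).and (h'.eventually_mem hν')).exists
  exact ht ht'

theorem normal_eq (h : IsOuterUnitNormal E x ν) : normal E x = ν := by
  have hex : ∃ ν, IsOuterUnitNormal E x ν := ⟨ν, h⟩
  rw [normal, dif_pos hex]
  exact hex.choose_spec.eq h

theorem isOuterUnitNormal_of_ball_subset (hν : ‖ν‖ = 1) {r : ℝ} (hr : 0 < r)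
    (hp : ball (x + r • ν) r ⊆ Eᶜ) (hq : ball (x - r • ν) r ⊆ E) : IsOuterUnitNormal E x ν := by
  refine ⟨hν, fun ε hε => ⟨2 * r * ε, by positivity, fun y hy => ⟨fun h => ?_, fun h => ?_⟩⟩⟩
  · refine hp ((mem_ball_add_smul_iff hν hr).2 ?_)
    nlinarith [norm_nonneg (y - x)]
  · refine hq ((mem_ball_sub_smul_iff hν hr).2 ?_)
    nlinarith [norm_nonneg (y - x)]

theorem isOuterUnitNormal_of_hasGradientAt {g : Space n → ℝ} (hg : HasGradientAt g v x)
    (hx : g x = 0) (hv : v ≠ 0) (hloc : ∀ᶠ y in 𝓝 x, (g y < 0 → y ∈ E) ∧ (0 < g y → y ∉ E)) :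
    IsOuterUnitNormal E x (‖v‖⁻¹ • v) := by
  have hpos : 0 < ‖v‖ := norm_pos_iff.2 hv
  refine ⟨norm_smul_inv_norm hv, fun ε hε => ?_⟩
  have ho := hg.hasFDerivAt.isLittleO.def (show 0 < ε * ‖v‖ by positivity)
  obtain ⟨δ, hδ, H⟩ := Metric.eventually_nhds_iff.1 (hloc.and ho)
  refine ⟨δ, hδ, fun y hy => ?_⟩
  obtain ⟨⟨hE, hE'⟩, hb⟩ := H (by rwa [dist_eq_norm])
  rw [hx, sub_zero, InnerProductSpace.toDual_apply_apply, real_inner_comm, Real.norm_eq_abs,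
    abs_le] at hb
  rw [real_inner_smul_right, inv_mul_eq_div, lt_div_iff₀ hpos, div_lt_iff₀ hpos]
  exact ⟨fun h => hE' (by linarith), fun h => hE (by linarith)⟩

theorem IsOuterUnitNormal.mem_tangentConeAt_frontier (h : IsOuterUnitNormal E x ν)
    (hv : inner ℝ v ν = 0) : v ∈ tangentConeAt ℝ (frontier E) x := by
  rw [tangentConeAt_eq_biInter_closure]
  refine mem_iInter₂.2 fun U hU => Metric.mem_closure_iff.2 fun ε hε => ?_
  have hνν : inner ℝ ν ν = (1 : ℝ) := by rw [real_inner_self_eq_norm_sq, h.1, one_pow]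
  have hout := h.eventually_notMem (v := v + (ε / 2) • ν) (by
    rw [inner_add_left, real_inner_smul_left, hv, hνν]; linarith)
  have hin := h.eventually_mem (v := v - (ε / 2) • ν) (by
    rw [inner_sub_left, real_inner_smul_left, hv, hνν]; linarith)
  obtain ⟨δ, hδ, hδU⟩ := Metric.mem_nhds_iff.1 hU
  have hsmall : ∀ᶠ t in 𝓝[>] (0 : ℝ), t ∈ Ioo 0 (δ / (‖v‖ + ε)) :=
    Ioo_mem_nhdsGT (by positivity)
  obtain ⟨t, hto, hti, ht0, ht⟩ := (hout.and (hin.and hsmall)).exists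
  obtain ⟨w, hw, hwE⟩ := exists_mem_segment_mem_frontier hti hto
  have hball : w ∈ closedBall (x + t • v) (t * (ε / 2)) := by
    refine (convex_closedBall _ _).segment_subset ?_ ?_ hw <;>
    simp [smul_add, smul_sub, dist_eq_norm, norm_smul, h.1, abs_of_pos ht0, abs_of_pos hε,
      add_sub_add_left_eq_sub]
  rw [mem_closedBall, dist_eq_norm, ← sub_sub] at hball
  refine ⟨t⁻¹ • (w - x), smul_mem_smul (mem_univ _) ⟨hδU ?_, by simpa using hwE⟩, ?_⟩
  · have htri := norm_le_norm_add_norm_sub' (w - x) (t • v)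
    rw [norm_smul, Real.norm_of_nonneg ht0.le] at htri
    rw [lt_div_iff₀ (by positivity)] at ht
    rw [mem_ball_zero_iff]
    nlinarith
  · rw [dist_comm, dist_eq_norm, ← inv_smul_smul₀ ht0.ne' v, ← smul_sub, norm_smul, norm_inv,
      Real.norm_of_nonneg ht0.le, inv_mul_lt_iff₀ ht0]
    nlinarith

end OuterNormal

section UniformBall

variable {n : ℕ} {E : Set (Space n)} {r : ℝ} {x y : Space n}

theorem uniformBall_iff : UniformBall E r ↔ 0 < r ∧ ∀ x ∈ frontier E,
    IsOuterUnitNormal E x (normal E x) ∧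
      ball (x + r • normal E x) r ⊆ Eᶜ ∧ ball (x - r • normal E x) r ⊆ E := by
  constructor
  · rintro ⟨hr, H⟩
    refine ⟨hr, fun x hx => ?_⟩
    obtain ⟨p, q, hp, hq, hxp, hxq⟩ := H x hx
    obtain ⟨ν, hν, rfl, rfl⟩ := exists_eq_add_smul_eq_sub_smul hr
      (disjoint_left.2 fun y hy hy' => hp hy (hq hy')) hxp hxq
    have hn := isOuterUnitNormal_of_ball_subset hν hr hp hq
    rw [normal_eq hn]
    exact ⟨hn, hp, hq⟩
  · rintro ⟨hr, H⟩
    refine ⟨hr, fun x hx => ⟨_, _, (H x hx).2.1, (H x hx).2.2, ?_, ?_⟩⟩ <;>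
    simp [norm_smul, (H x hx).1.1, hr.le]

theorem UniformBall.isOuterUnitNormal (h : UniformBall E r) (hx : x ∈ frontier E) :
    IsOuterUnitNormal E x (normal E x) :=
  ((uniformBall_iff.1 h).2 x hx).1

theorem UniformBall.norm_normal (h : UniformBall E r) (hx : x ∈ frontier E) :
    ‖normal E x‖ = 1 :=
  (h.isOuterUnitNormal hx).1

theorem UniformBall.outer_ball (h : UniformBall E r) (hx : x ∈ frontier E) :
    ball (x + r • normal E x) r ⊆ Eᶜ :=
  ((uniformBall_iff.1 h).2 x hx).2.1

theorem UniformBall.inner_ball (h : UniformBall E r) (hx : x ∈ frontier E) :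
    ball (x - r • normal E x) r ⊆ E :=
  ((uniformBall_iff.1 h).2 x hx).2.2

theorem UniformBall.compl (h : UniformBall E r) : UniformBall Eᶜ r := by
  refine ⟨h.1, fun x hx => ?_⟩
  obtain ⟨p, q, hp, hq, hxp, hxq⟩ := h.2 x (frontier_compl E ▸ hx)
  exact ⟨q, p, by rwa [compl_compl], hp, hxq, hxp⟩

theorem UniformBall.normal_compl (h : UniformBall E r) (hx : x ∈ frontier E) :
    normal Eᶜ x = -normal E x :=
  normal_eq (h.isOuterUnitNormal hx).compl

theorem UniformBall.mem_closure_interior (h : UniformBall E r) (hx : x ∈ frontier E) :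
    x ∈ closure (interior E) := by
  obtain ⟨-, q, -, hq, -, hxq⟩ := h.2 x hx
  have := closure_mono (interior_maximal hq isOpen_ball)
  rw [closure_ball _ h.1.ne'] at this
  exact this (sphere_subset_closedBall hxq)

theorem bddAbove_uniformBall (hbdd : Bornology.IsBounded E) (hne : E.Nonempty) :
    BddAbove {r : ℝ | UniformBall E r} := by
  obtain ⟨x, hx⟩ : (frontier E).Nonempty := nonempty_frontier_iff.2
    ⟨hne, fun h => NormedSpace.unbounded_univ ℝ (Space n) (h ▸ hbdd)⟩
  refine ⟨diam (closure E), fun r hr => ?_⟩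
  have hq : x - r • normal E x ∈ closure E :=
    subset_closure (hr.inner_ball hx (mem_ball_self hr.1))
  calc r = dist x (x - r • normal E x) := by
        rw [dist_self_sub_right, norm_smul, hr.norm_normal hx, mul_one, Real.norm_of_nonneg hr.1.le]
    _ ≤ diam (closure E) := dist_le_diam_of_mem hbdd.closure hx.1 hq

theorem UniformBall.mul_abs_inner_le (h : UniformBall E r) (hx : x ∈ frontier E)
    (hy : y ∈ frontier E) : 2 * r * |inner ℝ (y - x) (normal E x)| ≤ ‖y - x‖ ^ 2 := by
  have hν := h.norm_normal hx
  have houter : y ∉ ball (x + r • normal E x) r := fun hb => by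
    have := interior_maximal (h.outer_ball hx) isOpen_ball hb
    rw [interior_compl] at this
    exact this hy.1
  have hinner : y ∉ ball (x - r • normal E x) r := fun hb =>
    hy.2 (interior_maximal (h.inner_ball hx) isOpen_ball hb)
  rw [mem_ball_add_smul_iff hν h.1, not_lt] at houter
  rw [mem_ball_sub_smul_iff hν h.1, not_lt] at hinner
  rw [← abs_of_pos (show 0 < 2 * r by linarith [h.1]), ← abs_mul]
  exact abs_le.2 ⟨by linarith, houter⟩

theorem UniformBall.outer_ball_of_inner_le {r₀ : ℝ} (h : UniformBall E r₀) (hr : 0 < r)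
    (hx : x ∈ frontier E)
    (hle : ∀ y ∈ frontier E, 2 * r * inner ℝ (y - x) (normal E x) ≤ ‖y - x‖ ^ 2) :
    ball (x + r • normal E x) r ⊆ Eᶜ := by
  have hν := h.norm_normal hx
  have hmem : ∀ {s : ℝ}, min r r₀ ≤ s →
      x + min r r₀ • normal E x ∈ ball (x + s • normal E x) s := by
    intro s hs
    have : 0 < min r r₀ := lt_min hr h.1
    rw [mem_ball, dist_add_left, dist_eq_norm, ← sub_smul, norm_smul, hν, mul_one, Real.norm_eq_abs,
      abs_lt]
    constructor <;> linarith
  refine subset_of_disjoint_frontier (convex_ball _ _).isPreconnected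
    (disjoint_left.2 fun y hy hyE => ?_)
    ⟨_, hmem (min_le_left _ _), h.outer_ball hx (hmem (min_le_right _ _))⟩
  rw [frontier_compl] at hyE
  exact ((mem_ball_add_smul_iff hν hr).1 hy).not_ge (hle y hyE)

theorem UniformBall.uniformBall_iff_inner_le {r₀ : ℝ} (h : UniformBall E r₀) (hr : 0 < r) :
    UniformBall E r ↔ ∀ x ∈ frontier E, ∀ y ∈ frontier E,
      2 * r * |inner ℝ (y - x) (normal E x)| ≤ ‖y - x‖ ^ 2 := by
  refine ⟨fun h x hx y hy => h.mul_abs_inner_le hx hy, fun H => uniformBall_iff.2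
    ⟨hr, fun x hx => ⟨h.isOuterUnitNormal hx, h.outer_ball_of_inner_le hr hx fun y hy => ?_, ?_⟩⟩⟩
  · exact (mul_le_mul_of_nonneg_left (le_abs_self _) (by positivity)).trans (H x hx y hy)
  · have := h.compl.outer_ball_of_inner_le hr (frontier_compl E ▸ hx) fun y hy => by
      rw [h.normal_compl hx, inner_neg_right]
      exact (mul_le_mul_of_nonneg_left (neg_le_abs _) (by positivity)).trans
        (H x hx y (frontier_compl E ▸ hy))
    rwa [h.normal_compl hx, smul_neg, ← sub_eq_add_neg, compl_compl] at this

theorem UniformBall.mul_norm_normal_sub_le (h : UniformBall E r) (hx : x ∈ frontier E)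
    (hy : y ∈ frontier E) : r * ‖normal E x - normal E y‖ ≤ ‖x - y‖ := by
  have hfar : ∀ {a b : Space n}, a ∈ frontier E → b ∈ frontier E →
      2 * r ≤ ‖r • (normal E a + normal E b) + (a - b)‖ := fun {a b} ha hb => by
    have := (disjoint_ball_ball_iff h.1 h.1).1 (disjoint_left.2 fun z hz hz' =>
      h.outer_ball ha hz (h.inner_ball hb hz'))
    rw [← two_mul, dist_eq_norm] at this
    exact this.trans_eq (congrArg norm (by rw [smul_add]; abel))
  have hxy := hfar hx hy
  have hyx := hfar hy hx
  rw [add_comm (normal E y), ← neg_sub x y, ← sub_eq_add_neg] at hyx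
  have hpar := parallelogram_law_with_norm ℝ (r • (normal E x + normal E y)) (x - y)
  have hpar' := parallelogram_law_with_norm ℝ (normal E x) (normal E y)
  rw [h.norm_normal hx, h.norm_normal hy] at hpar'
  rw [norm_smul, Real.norm_of_nonneg h.1.le] at hpar
  have hr := h.1
  refine le_of_sq_le_sq ?_ (norm_nonneg _)
  nlinarith [mul_self_le_mul_self (by positivity) hxy, mul_self_le_mul_self (by positivity) hyx]

end UniformBall

section TwoPoint

variable {n : ℕ} {E : Set (Space n)} {r r₀ : ℝ} {x y : Space n}

theorem abs_twoPoint_le_iff (hr : 0 < r) (hxy : x ≠ y) : |twoPoint E x y| ≤ (2 * r)⁻¹ ↔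
    2 * r * |inner ℝ (y - x) (normal E x)| ≤ ‖y - x‖ ^ 2 := by
  have hpos : 0 < ‖y - x‖ ^ 2 := pow_pos (norm_pos_iff.2 (sub_ne_zero.2 hxy.symm)) 2
  rw [twoPoint, ← neg_sub y x, inner_neg_left, norm_neg, abs_div, abs_neg, abs_of_pos hpos,
    div_le_iff₀ hpos, le_inv_mul_iff₀ (by positivity)]

theorem UniformBall.uniformBall_iff_mem_upperBounds (h : UniformBall E r₀) (hr : 0 < r) :
    UniformBall E r ↔ (2 * r)⁻¹ ∈ upperBounds (twoPointValues E) := by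
  rw [h.uniformBall_iff_inner_le hr]
  constructor
  · rintro H _ ⟨x, hx, y, hy, hxy, rfl⟩
    exact (abs_twoPoint_le_iff hr hxy).2 (H x hx y hy)
  · intro H x hx y hy
    rcases eq_or_ne x y with rfl | hxy
    · simp
    · exact (abs_twoPoint_le_iff hr hxy).1 (H ⟨x, hx, y, hy, hxy, rfl⟩)

theorem UniformBall.twoPointValues_nonempty (h : UniformBall E r₀)
    (hbdd : BddAbove {r : ℝ | UniformBall E r}) : (twoPointValues E).Nonempty := by
  by_contra! hempty
  obtain ⟨R, hR⟩ := hbdd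
  have hpos : 0 < R + 1 := by linarith [h.1, hR h]
  have := hR ((h.uniformBall_iff_mem_upperBounds hpos).2 (by simp [hempty]))
  linarith

theorem UniformBall.isLUB_twoPointNorm (h : UniformBall E r₀)
    (hbdd : BddAbove {r : ℝ | UniformBall E r}) : IsLUB (twoPointValues E) (twoPointNorm E) :=
  isLUB_csSup (h.twoPointValues_nonempty hbdd) ⟨_, (h.uniformBall_iff_mem_upperBounds h.1).1 h⟩

theorem UniformBall.uniformBall_iff_two_mul_twoPointNorm_le (h : UniformBall E r₀)
    (hbdd : BddAbove {r : ℝ | UniformBall E r}) (hr : 0 < r) :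
    UniformBall E r ↔ 2 * twoPointNorm E ≤ r⁻¹ := by
  rw [h.uniformBall_iff_mem_upperBounds hr, ← isLUB_le_iff (h.isLUB_twoPointNorm hbdd), mul_inv,
    le_inv_mul_iff₀ two_pos]

theorem UniformBall.twoPointNorm_pos (h : UniformBall E r₀)
    (hbdd : BddAbove {r : ℝ | UniformBall E r}) : 0 < twoPointNorm E := by
  by_contra! hle
  obtain ⟨R, hR⟩ := hbdd
  have hpos : 0 < R + 1 := by linarith [h.1, hR h]
  have := hR ((h.uniformBall_iff_two_mul_twoPointNorm_le ⟨R, hR⟩ hpos).2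
    ((mul_nonpos_of_nonneg_of_nonpos zero_le_two hle).trans (by positivity)))
  linarith

theorem UniformBall.isGreatest_inv_two_mul_twoPointNorm (h : UniformBall E r₀)
    (hbdd : BddAbove {r : ℝ | UniformBall E r}) :
    IsGreatest {r : ℝ | UniformBall E r} (2 * twoPointNorm E)⁻¹ := by
  have hpos : 0 < 2 * twoPointNorm E := mul_pos two_pos (h.twoPointNorm_pos hbdd)
  have hiff : ∀ {r : ℝ}, 0 < r → (UniformBall E r ↔ 2 * twoPointNorm E ≤ r⁻¹) :=
    h.uniformBall_iff_two_mul_twoPointNorm_le hbdd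
  exact ⟨(hiff (inv_pos.2 hpos)).2 (inv_inv _).ge,
    fun r hr => (le_inv_comm₀ hpos hr.1).1 ((hiff hr.1).1 hr)⟩

theorem UniformBall.maxRadius_eq (h : UniformBall E r₀)
    (hbdd : BddAbove {r : ℝ | UniformBall E r}) : maxRadius E = (2 * twoPointNorm E)⁻¹ :=
  (h.isGreatest_inv_two_mul_twoPointNorm hbdd).csSup_eq

theorem UniformBall.isGreatest_maxRadius (h : UniformBall E r₀)
    (hbdd : BddAbove {r : ℝ | UniformBall E r}) :
    IsGreatest {r : ℝ | UniformBall E r} (maxRadius E) :=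
  h.maxRadius_eq hbdd ▸ h.isGreatest_inv_two_mul_twoPointNorm hbdd

end TwoPoint

section Touching

variable {V : Type*} [NormedAddCommGroup V] [NormedSpace ℝ V] {f g h : V → ℝ} {f' g' : V →L[ℝ] ℝ}
  {x : V}

theorem hasFDerivAt_eq_of_le (hf : HasFDerivAt f f' x) (hg : HasFDerivAt g g' x)
    (hfg : ∀ y, f y ≤ g y) (hx : f x = g x) : f' = g' := by
  have hmin : IsLocalMin (g - f) x := Eventually.of_forall fun y => by
    simpa only [Pi.sub_apply, hx, sub_self, sub_nonneg] using hfg y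
  exact (sub_eq_zero.1 (hmin.hasFDerivAt_eq_zero (hg.sub hf))).symm

theorem differentiableAt_of_squeeze (hf : DifferentiableAt ℝ f x) (hh : DifferentiableAt ℝ h x)
    (hfg : ∀ y, f y ≤ g y) (hgh : ∀ y, g y ≤ h y) (hx : f x = h x) : DifferentiableAt ℝ g x := by
  have hgx : g x = f x := ((hgh x).trans hx.ge).antisymm (hfg x)
  have hder : fderiv ℝ f x = fderiv ℝ h x :=
    hasFDerivAt_eq_of_le hf.hasFDerivAt hh.hasFDerivAt (fun y => (hfg y).trans (hgh y)) hx
  have hf' := hf.hasFDerivAt.isLittleO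
  have hh' := hh.hasFDerivAt.isLittleO
  rw [← hder] at hh'
  refine HasFDerivAt.differentiableAt (f' := fderiv ℝ f x) (.of_isLittleO ?_)
  refine (Asymptotics.IsBigO.of_bound 1 (Eventually.of_forall fun y => ?_)).trans_isLittleO
    (hf'.norm_left.add hh'.norm_left)
  simp only [Real.norm_eq_abs, one_mul]
  rw [abs_of_nonneg (add_nonneg (abs_nonneg (f y - f x - _)) (abs_nonneg _)), hgx, ← hx]
  refine (abs_le_max_abs_abs (sub_le_sub_right (sub_le_sub_right (hfg y) _) _)
    (sub_le_sub_right (sub_le_sub_right (hgh y) _) _)).trans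
    (max_le_add_of_nonneg (abs_nonneg _) (abs_nonneg _))

end Touching

section Distance

variable {V : Type*} [NormedAddCommGroup V] [InnerProductSpace ℝ V] {K : Set V}

theorem eq_add_smul_of_isMaxOn_closedBall [CompleteSpace V] {f : V → ℝ} {z w u : V} {h : ℝ}
    (hw : w ∈ closedBall z h) (hmax : IsMaxOn f (closedBall z h) w) (hu : HasGradientAt f u w)
    (hu1 : ‖u‖ = 1) : w = z + h • u := by
  have hh : 0 ≤ h := dist_nonneg.trans hw
  have hzu : z + h • u ∈ closedBall z h := by
    simp [norm_smul, hu1, abs_of_nonneg hh]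
  have hle : inner ℝ u (z + h • u - w) ≤ 0 :=
    hmax.localize.hasFDerivWithinAt_nonpos hu.hasFDerivAt.hasFDerivWithinAt
      (sub_mem_posTangentConeAt_of_segment_subset ((convex_closedBall z h).segment_subset hw hzu))
  rw [mem_closedBall, dist_eq_norm] at hw
  refine (sub_eq_iff_eq_add'.1 (eq_smul_of_le_inner hu1 hw ?_))
  rw [add_sub_right_comm, ← neg_sub w z, inner_add_right, inner_neg_right, real_inner_smul_right,
    real_inner_self_eq_norm_sq, hu1, real_inner_comm] at hle
  linarith

theorem infDist_smul_gradient_eq [CompleteSpace V] {w y u : V}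
    (hu : HasGradientAt (fun v => infDist v K) u w) (hy : y ∈ closure K)
    (hwy : infDist w K = dist w y) : infDist w K • u = w - y := by
  have hsq := hasFDerivAt_eq_of_le (hu.hasFDerivAt.pow 2)
    ((hasFDerivAt_id w).sub_const y).norm_sq (fun v => by
      have := infDist_le_dist_of_mem (x := v) hy
      rw [infDist_closure, dist_eq_norm] at this
      exact pow_le_pow_left₀ infDist_nonneg this 2)
    (by simp only [hwy, dist_eq_norm, id])
  refine ext_inner_right ℝ fun v => ?_
  have := congrArg (fun L : V →L[ℝ] ℝ => L v) hsq
  simp only [id_eq, Nat.add_one_sub_one, pow_one, nsmul_eq_mul, Nat.cast_ofNat, innerSL_apply_apply,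
    smul_apply, InnerProductSpace.toDual_apply_apply, smul_eq_mul,
    ContinuousLinearMap.comp_id] at this
  rw [real_inner_smul_left]
  linarith

theorem norm_gradient_infDist_eq_one [ProperSpace V] {w u : V}
    (hu : HasGradientAt (fun v => infDist v K) u w) (hw : 0 < infDist w K) : ‖u‖ = 1 := by
  have hK : K.Nonempty := nonempty_iff_ne_empty.2 fun h => by simp [h] at hw
  obtain ⟨y, hy, hwy⟩ := exists_mem_closure_infDist_eq_dist hK w
  have := congrArg norm (infDist_smul_gradient_eq hu hy hwy)
  rw [norm_smul, Real.norm_of_nonneg hw.le, ← dist_eq_norm, ← hwy] at this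
  exact mul_eq_left₀ hw.ne' |>.1 this

theorem exists_infDist_add_smul_eq_add [ProperSpace V] {z : V} {h : ℝ} (hh : 0 ≤ h)
    (hhz : h ≤ infDist z K) (hz : 0 < infDist z K)
    (hdiff : ∀ w ∈ closedBall z h, DifferentiableAt ℝ (fun v => infDist v K) w) :
    ∃ u : V, ‖u‖ = 1 ∧ z - infDist z K • u ∈ closure K ∧
      infDist (z + h • u) K = infDist z K + h := by
  have hzh : z ∈ closedBall z h := mem_closedBall_self hh
  obtain ⟨w, hw, hmax⟩ := (isCompact_closedBall z h).exists_isMaxOn ⟨z, hzh⟩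
    (continuous_infDist_pt K).continuousOn
  have hzw : infDist z K ≤ infDist w K := hmax hzh
  obtain ⟨u, hu⟩ : ∃ u, HasGradientAt (fun v => infDist v K) u w :=
    ⟨_, (hdiff w hw).hasGradientAt⟩
  have hu1 : ‖u‖ = 1 := norm_gradient_infDist_eq_one hu (hz.trans_le hzw)
  have hwz : w = z + h • u := eq_add_smul_of_isMaxOn_closedBall hw hmax hu hu1
  have hK : K.Nonempty := nonempty_iff_ne_empty.2 fun h => by simp [h] at hz
  obtain ⟨y, hy, hwy⟩ := exists_mem_closure_infDist_eq_dist hK w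
  have hyz : z - y = (infDist w K - h) • u := by
    rw [sub_smul, infDist_smul_gradient_eq hu hy hwy, hwz]
    abel
  have hdist : infDist z K ≤ infDist w K - h := by
    rw [← infDist_closure]
    refine (infDist_le_dist_of_mem hy).trans_eq ?_
    rw [dist_eq_norm, hyz, norm_smul, hu1, mul_one, Real.norm_of_nonneg (by linarith)]
  have hwh : infDist w K ≤ infDist z K + h :=
    infDist_le_infDist_add_dist.trans (add_le_add_right hw _)
  have hwK : infDist w K = infDist z K + h := by linarith
  refine ⟨u, hu1, ?_, hwz ▸ hwK⟩
  rwa [← add_sub_cancel_right (infDist z K) h, ← hwK, ← hyz, sub_sub_cancel]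

-- The gradient at `x + R • ν` determines its nearest point in `closure K`, which is thus `x`.
theorem infDist_add_smul_eq_add [ProperSpace V] {x ν : V} {R h : ℝ} (hx : x ∈ closure K)
    (hν : ‖ν‖ = 1) (hh : 0 ≤ h) (hhR : h ≤ R) (hR : 0 < R) (hd : infDist (x + R • ν) K = R)
    (hdiff : ∀ w ∈ closedBall (x + R • ν) h, DifferentiableAt ℝ (fun v => infDist v K) w) :
    infDist (x + (R + h) • ν) K = R + h := by
  obtain ⟨u, hu, hy, hdu⟩ := exists_infDist_add_smul_eq_add hh (hhR.trans_eq hd.symm)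
    (hR.trans_eq hd.symm) hdiff
  rw [hd] at hy hdu
  have hgrad := (hdiff _ (mem_closedBall_self hh)).hasGradientAt
  have huν : R • u = R • ν := by
    have hfx := infDist_smul_gradient_eq hgrad hx (by
      rw [hd, dist_self_add_left, norm_smul, hν, mul_one, Real.norm_of_nonneg hR.le])
    have hfy := infDist_smul_gradient_eq hgrad hy (by
      rw [hd, dist_eq_norm, sub_sub_cancel, norm_smul, hu, mul_one, Real.norm_of_nonneg hR.le])
    rw [hfx, add_sub_cancel_left, sub_sub_cancel] at hfy
    exact hfy.symm
  rwa [smul_right_injective V hR.ne' huν, add_assoc, ← add_smul] at hdu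

end Distance

section SignedDist

theorem infDist_le_dist_sub_of_ball_subset {V : Type*} [NormedAddCommGroup V] [NormedSpace ℝ V]
    {s : Set V} {q y : V} {r : ℝ} (hr : 0 < r) (hq : ball q r ⊆ s) (hy : r ≤ dist y q) :
    infDist y s ≤ dist y q - r := by
  have hpos : 0 < dist y q := hr.trans_le hy
  have hw : AffineMap.lineMap q y (r / dist y q) ∈ closedBall q r := by
    rw [mem_closedBall, dist_lineMap_left, Real.norm_of_nonneg (by positivity), dist_comm q y,
      div_mul_cancel₀ _ hpos.ne']
  calc infDist y s ≤ infDist y (ball q r) := infDist_le_infDist_of_subset hq ⟨q, mem_ball_self hr⟩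
    _ = infDist y (closedBall q r) := by rw [← closure_ball q hr.ne', infDist_closure]
    _ ≤ dist y (AffineMap.lineMap q y (r / dist y q)) := infDist_le_dist_of_mem hw
    _ = dist y q - r := by
      rw [dist_comm, dist_lineMap_right, dist_comm q y, Real.norm_of_nonneg
        (sub_nonneg.2 ((div_le_one hpos).2 hy)), sub_mul, div_mul_cancel₀ _ hpos.ne', one_mul]

variable {n : ℕ} {E : Set (Space n)} {x y z p q : Space n} {r t R h : ℝ}

theorem signedDist_of_notMem (hx : x ∉ E) : signedDist E x = infDist x E := if_neg hx

theorem signedDist_compl (E : Set (Space n)) (x : Space n) :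
    signedDist Eᶜ x = -signedDist E x := by
  by_cases hx : x ∈ E <;> simp [signedDist, hx]

theorem signedDist_le_dist_sub (hr : 0 < r) (hq : ball q r ⊆ E) (hE : Eᶜ.Nonempty) (y : Space n) :
    signedDist E y ≤ dist y q - r := by
  by_cases hy : y ∈ E
  · rw [signedDist, if_pos hy, neg_le, neg_sub, le_infDist hE]
    intro c hc
    have hcr : r ≤ dist c q := not_lt.1 fun hlt => hc (hq hlt)
    linarith [dist_triangle c y q, dist_comm c y]
  · rw [signedDist_of_notMem hy]
    exact infDist_le_dist_sub_of_ball_subset hr hq (not_lt.1 fun hlt => hy (hq hlt))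

theorem sub_dist_le_signedDist (hr : 0 < r) (hp : ball p r ⊆ Eᶜ) (hE : E.Nonempty) (y : Space n) :
    r - dist y p ≤ signedDist E y := by
  have := signedDist_le_dist_sub hr hp (by rwa [compl_compl]) y
  rw [signedDist_compl] at this
  linarith

theorem differentiableAt_signedDist (hr : 0 < r) (hp : ball p r ⊆ Eᶜ) (hq : ball q r ⊆ E)
    (hzp : z ≠ p) (hzq : z ≠ q) (hz : dist z p + dist z q = r + r) :
    DifferentiableAt ℝ (signedDist E) z := by
  have hdiff : ∀ {c : Space n}, z ≠ c → DifferentiableAt ℝ (fun y => dist y c) z := fun hc =>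
    differentiableAt_id.dist ℝ (differentiableAt_const _) hc
  refine differentiableAt_of_squeeze ((hdiff hzp).const_sub r) ((hdiff hzq).sub_const r)
    (sub_dist_le_signedDist hr hp ⟨q, hq (mem_ball_self hr)⟩)
    (signedDist_le_dist_sub hr hq ⟨p, hp (mem_ball_self hr)⟩) ?_
  linarith

theorem UniformBall.eq_sub_smul_normal (h : UniformBall E r) (hx : x ∈ frontier E)
    (hz : ball z (dist z x) ⊆ E) : z = x - dist z x • normal E x := by
  rcases eq_or_ne z x with rfl | hzx
  · simp
  have hν := h.norm_normal hx
  have hdist := (disjoint_ball_ball_iff (dist_pos.2 hzx) h.1).1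
    (disjoint_left.2 fun y hy hy' => h.outer_ball hx hy' (hz hy))
  rw [dist_comm z (x + r • normal E x), dist_eq_norm (x + r • normal E x), add_sub_right_comm]
    at hdist
  have hsq := norm_add_sq_real (x - z) (r • normal E x)
  rw [norm_smul, hν, mul_one, Real.norm_of_nonneg h.1.le, real_inner_smul_right, ← dist_eq_norm,
    dist_comm x z] at hsq
  have hle : dist z x ≤ inner ℝ (x - z) (normal E x) := by
    have := pow_le_pow_left₀ (add_nonneg dist_nonneg h.1.le) hdist 2
    refine le_of_mul_le_mul_left ?_ h.1
    linarith
  rw [← eq_smul_of_le_inner hν (by rw [← dist_eq_norm, dist_comm]) hle, sub_sub_cancel]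

theorem UniformBall.exists_eq_sub_smul_normal (h : UniformBall E r) (hzE : z ∈ E)
    (hz : z ∈ thickening t (frontier E)) :
    ∃ x ∈ frontier E, ∃ s, 0 ≤ s ∧ s < t ∧ z = x - s • normal E x := by
  obtain ⟨c, hc, hzc⟩ := mem_thickening_iff.1 hz
  have hcE : c ∈ closure Eᶜ := frontier_subset_closure (frontier_compl E ▸ hc)
  obtain ⟨x, hx, hzx⟩ := exists_mem_frontier_infDist_compl_eq_dist hzE
    (nonempty_compl.1 (closure_nonempty_iff.1 ⟨c, hcE⟩))
  have hlt : dist z x < t := by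
    rw [← hzx, ← infDist_closure]
    exact (infDist_le_dist_of_mem hcE).trans_lt hzc
  exact ⟨x, hx, dist z x, dist_nonneg, hlt,
    h.eq_sub_smul_normal hx (hzx ▸ ball_infDist_compl_subset)⟩

theorem UniformBall.exists_eq_add_smul_normal (h : UniformBall E r)
    (hz : z ∈ thickening t (frontier E)) :
    ∃ x ∈ frontier E, ∃ s, |s| < t ∧ z = x + s • normal E x := by
  by_cases hzE : z ∈ E
  · obtain ⟨x, hx, s, hs, hst, rfl⟩ := h.exists_eq_sub_smul_normal hzE hz
    exact ⟨x, hx, -s, by rwa [abs_neg, abs_of_nonneg hs], by rw [neg_smul, sub_eq_add_neg]⟩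
  · rw [← frontier_compl] at hz
    obtain ⟨x, hx, s, hs, hst, rfl⟩ := h.compl.exists_eq_sub_smul_normal hzE hz
    rw [frontier_compl] at hx
    exact ⟨x, hx, s, by rwa [abs_of_nonneg hs], by rw [h.normal_compl hx, smul_neg, sub_neg_eq_add]⟩

theorem UniformBall.mem_diffRadii (h : UniformBall E r) : r ∈ diffRadii E := by
  refine ⟨h.1, fun z hz => DifferentiableAt.differentiableWithinAt ?_⟩
  obtain ⟨x, hx, t, ht, rfl⟩ := h.exists_eq_add_smul_normal hz
  have hν := h.norm_normal hx
  obtain ⟨ht1, ht2⟩ := abs_lt.1 ht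
  have hp : dist (x + t • normal E x) (x + r • normal E x) = r - t := by
    rw [dist_add_left, dist_comm, dist_eq_norm, ← sub_smul, norm_smul, hν, mul_one,
      Real.norm_of_nonneg (by linarith)]
  have hq : dist (x + t • normal E x) (x - r • normal E x) = r + t := by
    rw [sub_eq_add_neg, dist_add_left, dist_eq_norm, sub_neg_eq_add, ← add_smul, norm_smul, hν,
      mul_one, Real.norm_of_nonneg (by linarith), add_comm]
  refine differentiableAt_signedDist h.1 (h.outer_ball hx) (h.inner_ball hx) ?_ ?_ ?_
  · exact dist_pos.1 (by rw [hp]; linarith)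
  · exact dist_pos.1 (by rw [hq]; linarith)
  · rw [hp, hq]
    ring

theorem UniformBall.outer_ball_add (hU : UniformBall E R) (hx : x ∈ frontier E)
    (hdiff : DifferentiableOn ℝ (signedDist E) (thickening t (frontier E))) (hh : 0 ≤ h)
    (hhR : h < R) (ht : R + h < t) :
    ball (x + (R + h) • normal E x) (R + h) ⊆ Eᶜ := by
  have hν := hU.norm_normal hx
  have hxE : x ∈ closure E := frontier_subset_closure hx
  have hdist : dist (x + R • normal E x) x = R := by
    rw [dist_self_add_left, norm_smul, hν, mul_one, Real.norm_of_nonneg hU.1.le]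
  have hinf : infDist (x + R • normal E x) E = R := by
    refine le_antisymm ?_ ((le_infDist (closure_nonempty_iff.1 ⟨x, hxE⟩)).2 fun y hy => ?_)
    · rw [← infDist_closure]
      exact (infDist_le_dist_of_mem hxE).trans_eq hdist
    · exact not_lt.1 fun hlt => hU.outer_ball hx (mem_ball'.2 hlt) hy
  have key : ∀ w ∈ closedBall (x + R • normal E x) h,
      DifferentiableAt ℝ (fun v => infDist v E) w := by
    intro w hw
    have hwt : w ∈ thickening t (frontier E) := mem_thickening_iff.2 ⟨x, hx, by
      linarith [dist_triangle w (x + R • normal E x) x, mem_closedBall.1 hw]⟩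
    refine (hdiff.differentiableAt (isOpen_thickening.mem_nhds hwt)).congr_of_eventuallyEq ?_
    filter_upwards [isOpen_ball.mem_nhds (closedBall_subset_ball hhR hw)] with v hv
    exact (signedDist_of_notMem (hU.outer_ball hx hv)).symm
  have := ball_infDist_subset_compl (s := E) (x := x + (R + h) • normal E x)
  rwa [infDist_add_smul_eq_add hxE hν hh hhR.le hU.1 hinf key] at this

theorem UniformBall.add (hU : UniformBall E R) (ht : t ∈ diffRadii E) (hh : 0 ≤ h) (hhR : h < R)
    (hRt : R + h < t) : UniformBall E (R + h) := by
  refine uniformBall_iff.2 ⟨by linarith, fun x hx => ⟨hU.isOuterUnitNormal hx,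
    hU.outer_ball_add hx ht.2 hh hhR hRt, ?_⟩⟩
  have hdiff : DifferentiableOn ℝ (signedDist Eᶜ) (thickening t (frontier Eᶜ)) := by
    rw [frontier_compl, funext (signedDist_compl E)]
    exact ht.2.neg
  have := hU.compl.outer_ball_add (frontier_compl E ▸ hx) hdiff hh hhR hRt
  rwa [compl_compl, hU.normal_compl hx, smul_neg, ← sub_eq_add_neg] at this

theorem isGreatest_diffRadii (hR : IsGreatest {r | UniformBall E r} R) :
    IsGreatest (diffRadii E) R := by
  have hU : UniformBall E R := hR.1
  refine ⟨hU.mem_diffRadii, fun t ht => ?_⟩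
  by_contra! hlt
  have hR0 := hU.1
  have hpos : 0 < min (R / 2) ((t - R) / 2) := lt_min (by linarith) (by linarith)
  have hadd : UniformBall E (R + min (R / 2) ((t - R) / 2)) :=
    hU.add ht hpos.le (by linarith [min_le_left (R / 2) ((t - R) / 2)])
      (by linarith [min_le_right (R / 2) ((t - R) / 2)])
  linarith [hR.2 hadd]

end SignedDist

section Regular

variable {n k : ℕ} {E : Set (Space n)} {g : Space n → ℝ} {x : Space n} {r : ℝ}

/-- `g` defines `E` near `x`: the open sublevel set of `g` lies in `E`, the open superlevel set in
the complement, and the boundary of `E` in the zero set. No regularity of `g` is included. -/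
def IsDefiningFunctionAt (E : Set (Space n)) (g : Space n → ℝ) (x : Space n) : Prop :=
  ∀ᶠ y in 𝓝 x, (g y < 0 → y ∈ E) ∧ (0 < g y → y ∉ E) ∧ (y ∈ frontier E → g y = 0)

theorem IsDefiningFunctionAt.of_mem_interior_iff (hE : frontier E ⊆ closure (interior E))
    {C : Set (Space n)} (hC : IsOpen C) (hx : x ∈ C) (hg : ContinuousOn g C)
    (hint : ∀ y ∈ C, (y ∈ interior E ↔ g y < 0)) : IsDefiningFunctionAt E g x := by
  have hfr : ∀ y ∈ C, y ∈ frontier E → g y = 0 := by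
    refine fun y hy hyE => le_antisymm (not_lt.1 fun hpos => ?_)
      (not_lt.1 fun hneg => hyE.2 ((hint y hy).2 hneg))
    have hev : ∀ᶠ z in 𝓝 y, z ∈ C ∧ 0 < g z := Filter.Eventually.and (hC.mem_nhds hy)
      ((hg.continuousAt (hC.mem_nhds hy)).eventually (eventually_gt_nhds hpos))
    obtain ⟨z, ⟨hzC, hz⟩, hzE⟩ := mem_closure_iff_nhds.1 (hE hyE) _ hev
    exact hz.not_gt ((hint z hzC).1 hzE)
  filter_upwards [hC.mem_nhds hx] with y hy
  exact ⟨fun hneg => interior_subset ((hint y hy).2 hneg), fun hpos hyE => hpos.ne'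
    (hfr y hy ⟨subset_closure hyE, fun hi => hpos.not_gt ((hint y hy).1 hi)⟩), hfr y hy⟩

theorem exists_contDiffOn_mem_interior_iff (hreg : IsRegular k E) (hk : k ≠ 0)
    (hx : x ∈ frontier E) :
    ∃ (g : Space n → ℝ) (C : Set (Space n)), IsOpen C ∧ x ∈ C ∧ ContDiffOn ℝ k g C ∧
      gradient g x ≠ 0 ∧ ∀ y ∈ C, (y ∈ interior E ↔ g y < 0) := by
  obtain ⟨Φ, ρ, hρ, R, hR, f, hf, -, H⟩ := hreg x hx
  set L₁ : Space n →L[ℝ] EuclideanSpace ℝ (Fin n) :=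
    (WithLp.fstL 2 ℝ (EuclideanSpace ℝ (Fin n)) ℝ).comp
      (Φ.toContinuousLinearEquiv : Space n →L[ℝ] _)
  set L₂ : Space n →L[ℝ] ℝ := (WithLp.sndL 2 ℝ (EuclideanSpace ℝ (Fin n)) ℝ).comp
    (Φ.toContinuousLinearEquiv : Space n →L[ℝ] _)
  have hC : IsOpen {y : Space n | ‖L₁ (y - x)‖ < ρ ∧ |L₂ (y - x)| < R} :=
    (isOpen_lt (f := fun y => ‖L₁ (y - x)‖) (by fun_prop) continuous_const).inter
      (isOpen_lt (f := fun y => |L₂ (y - x)|) (by fun_prop) continuous_const)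
  have hxC : x ∈ {y : Space n | ‖L₁ (y - x)‖ < ρ ∧ |L₂ (y - x)| < R} := by simp [hρ, hR]
  have hg : ContDiffOn ℝ k (fun y => L₂ (y - x) - f (L₁ (y - x)))
      {y : Space n | ‖L₁ (y - x)‖ < ρ ∧ |L₂ (y - x)| < R} :=
    ContDiffOn.sub (by fun_prop) (hf.comp (by fun_prop) fun y hy => mem_ball_zero_iff.2 hy.1)
  refine ⟨_, _, hC, hxC, hg, fun hgrad => ?_, fun y hy => (H y hy.1 hy.2).trans sub_neg.symm⟩
  -- `g` grows with unit speed along the vertical direction `v` of the graph.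
  set v : Space n := Φ.symm (WithLp.toLp 2 (0, 1))
  have hv₁ : L₁ v = 0 := congrArg WithLp.fst (Φ.apply_symm_apply (WithLp.toLp 2 (0, 1)))
  have hv₂ : L₂ v = 1 := congrArg WithLp.snd (Φ.apply_symm_apply (WithLp.toLp 2 (0, 1)))
  have hgx := ((hg.contDiffAt (hC.mem_nhds hxC)).differentiableAt
    (by exact_mod_cast hk)).hasGradientAt
  rw [hgrad] at hgx
  have hline : HasDerivAt (fun s : ℝ => x + s • v) v 0 := by
    simpa using ((hasDerivAt_id (0 : ℝ)).smul_const v).const_add x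
  have hzero := hgx.hasFDerivAt.comp_hasDerivAt_of_eq 0 hline (by simp)
  have hone : HasDerivAt (fun s : ℝ => s - f 0) 1 0 := (hasDerivAt_id 0).sub_const _
  simpa using (hone.congr_of_eventuallyEq (Eventually.of_forall fun s => by
    simp [hv₁, hv₂])).unique hzero

theorem IsDefiningFunctionAt.differentiableWithinAt_normal (hE : IsDefiningFunctionAt E g x)
    (hg : ContDiffAt ℝ 2 g x) (hg0 : gradient g x ≠ 0) (hx : x ∈ frontier E) :
    DifferentiableWithinAt ℝ (normal E) (frontier E) x := by
  have hfderiv : DifferentiableAt ℝ (fderiv ℝ g) x :=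
    (hg.fderiv_right (m := 1) (by norm_num)).differentiableAt one_ne_zero
  have hgrad : DifferentiableAt ℝ (gradient g) x :=
    (InnerProductSpace.toDual ℝ (Space n)).symm.toContinuousLinearEquiv.differentiableAt.comp x
      hfderiv
  have hnormal : ∀ᶠ y in 𝓝 x, y ∈ frontier E →
      normal E y = ‖gradient g y‖⁻¹ • gradient g y := by
    filter_upwards [hE.eventually_nhds, hg.eventually (by simp),
      hgrad.continuousAt.eventually_ne hg0] with y hy hgy hy0 hyE
    exact normal_eq (isOuterUnitNormal_of_hasGradientAt
      (hgy.differentiableAt two_ne_zero).hasGradientAt (hy.self_of_nhds.2.2 hyE) hy0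
      (hy.mono fun z hz => ⟨hz.1, hz.2.1⟩))
  have hunit : DifferentiableAt ℝ (fun y => ‖gradient g y‖⁻¹ • gradient g y) x :=
    ((hgrad.norm ℝ hg0).inv (norm_ne_zero_iff.2 hg0)).smul hgrad
  exact hunit.differentiableWithinAt.congr_of_eventuallyEq
    (eventually_nhdsWithin_iff.2 hnormal) (hnormal.self_of_nhds hx)

theorem UniformBall.differentiableWithinAt_normal (h : UniformBall E r) (hreg : IsRegular 2 E)
    (hx : x ∈ frontier E) : DifferentiableWithinAt ℝ (normal E) (frontier E) x := by
  obtain ⟨g, C, hC, hxC, hg, hg0, hint⟩ := exists_contDiffOn_mem_interior_iff hreg two_ne_zero hx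
  have hdef := IsDefiningFunctionAt.of_mem_interior_iff (fun y hy => h.mem_closure_interior hy)
    hC hxC hg.continuousOn hint
  exact hdef.differentiableWithinAt_normal (hg.contDiffAt (hC.mem_nhds hxC)) hg0 hx

end Regular

section Curvature

theorem mul_norm_le_of_hasFDerivWithinAt {V W : Type*} [NormedAddCommGroup V] [NormedSpace ℝ V]
    [NormedAddCommGroup W] [NormedSpace ℝ W] {f : V → W} {f' : V →L[ℝ] W} {s : Set V} {x τ : V}
    {c : ℝ} (hf : HasFDerivWithinAt f f' s x) (hexp : ∀ y ∈ s, c * ‖f y - f x‖ ≤ ‖y - x‖)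
    (hτ : τ ∈ tangentConeAt ℝ s x) : c * ‖f' τ‖ ≤ ‖τ‖ := by
  obtain ⟨α, l, hl, a, d, hd0, hds, had⟩ := exists_fun_of_mem_tangentConeAt hτ
  have hlim := hf.lim hd0 hds had
  refine le_of_tendsto_of_tendsto (hlim.norm.const_mul c) had.norm (hds.mono fun i hi => ?_)
  have := hexp _ hi
  rw [add_sub_cancel_left] at this
  calc c * ‖a i • (f (x + d i) - f x)‖ = ‖a i‖ * (c * ‖f (x + d i) - f x‖) := by
        rw [norm_smul, mul_left_comm]
    _ ≤ ‖a i‖ * ‖d i‖ := by gcongr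
    _ = ‖a i • d i‖ := (norm_smul _ _).symm

variable {n : ℕ} {E : Set (Space n)} {A : Space n →L[ℝ] Space n} {x ν τ : Space n} {r K : ℝ}

theorem UniformBall.mul_norm_fderivWithin_normal_le (h : UniformBall E r) (hx : x ∈ frontier E)
    (hdiff : DifferentiableWithinAt ℝ (normal E) (frontier E) x)
    (hτ : inner ℝ τ (normal E x) = 0) :
    r * ‖fderivWithin ℝ (normal E) (frontier E) x τ‖ ≤ ‖τ‖ :=
  mul_norm_le_of_hasFDerivWithinAt hdiff.hasFDerivWithinAt
    (fun _ hy => h.mul_norm_normal_sub_le hy hx)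
    ((h.isOuterUnitNormal hx).mem_tangentConeAt_frontier hτ)

theorem secondForm_normal (hν : ‖normal E x‖ = 1) : secondForm E x (normal E x) = 0 := by
  simp [secondForm, tangentProj, hν]

theorem secondForm_of_inner_eq_zero (hτ : inner ℝ τ (normal E x) = 0) :
    secondForm E x τ = fderivWithin ℝ (normal E) (frontier E) x τ := by
  simp [secondForm, tangentProj, real_inner_comm, hτ]

theorem exists_orthonormalBasis_apply_zero_eq (hν : ‖ν‖ = 1) :
    ∃ b : OrthonormalBasis (Fin (n + 1)) ℝ (Space n), b 0 = ν := by
  obtain ⟨b, hb⟩ := Orthonormal.exists_orthonormalBasis_extension_of_card_eq (𝕜 := ℝ)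
    (E := Space n) (ι := Fin (n + 1)) (by simp) (v := fun _ => ν) (s := {0})
    ⟨fun _ => hν, fun i j hij => absurd (Subsingleton.elim i j) hij⟩
  exact ⟨b, hb 0 rfl⟩

theorem abs_trace_le_of_norm_apply_le (hν : ‖ν‖ = 1) (hA : A ν = 0)
    (hK : ∀ τ, inner ℝ τ ν = 0 → ‖A τ‖ ≤ K * ‖τ‖) :
    |LinearMap.trace ℝ (Space n) (A : Space n →ₗ[ℝ] Space n)| ≤ n * K := by
  obtain ⟨b, rfl⟩ := exists_orthonormalBasis_apply_zero_eq hν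
  have hbound (i : Fin n) : |inner ℝ (b i.succ) (A (b i.succ))| ≤ K := by
    have := hK _ (b.orthonormal.2 (Fin.succ_ne_zero i))
    simpa using (abs_real_inner_le_norm (b i.succ) (A (b i.succ))).trans
      (mul_le_mul_of_nonneg_left this (norm_nonneg _))
  rw [LinearMap.trace_eq_sum_inner _ b, Fin.sum_univ_succ]
  simp only [ContinuousLinearMap.coe_coe, hA, inner_zero_right, zero_add]
  calc |∑ i : Fin n, inner ℝ (b i.succ) (A (b i.succ))|
      ≤ ∑ i : Fin n, |inner ℝ (b i.succ) (A (b i.succ))| := Finset.abs_sum_le_sum_abs _ _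
    _ ≤ ∑ _ : Fin n, K := Finset.sum_le_sum fun i _ => hbound i
    _ = n * K := by simp

theorem frobenius_le_of_norm_apply_le (hν : ‖ν‖ = 1) (hA : A ν = 0) (hK0 : 0 ≤ K)
    (hK : ∀ τ, inner ℝ τ ν = 0 → ‖A τ‖ ≤ K * ‖τ‖) : frobenius A ≤ √n * K := by
  obtain ⟨b, rfl⟩ := exists_orthonormalBasis_apply_zero_eq hν
  have hbound (i : Fin n) : ‖A (b i.succ)‖ ≤ K := by
    simpa using hK _ (b.orthonormal.2 (Fin.succ_ne_zero i))
  rw [frobenius, LinearMap.trace_eq_sum_inner _ b, Fin.sum_univ_succ]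
  simp only [ContinuousLinearMap.coe_coe, ContinuousLinearMap.comp_apply,
    ContinuousLinearMap.adjoint_inner_right, hA, inner_zero_right, zero_add,
    real_inner_self_eq_norm_sq]
  calc √(∑ i : Fin n, ‖A (b i.succ)‖ ^ 2) ≤ √(∑ _ : Fin n, K ^ 2) := by
        gcongr with i
        exact hbound i
    _ = √n * K := by simp [Real.sqrt_sq hK0]

theorem UniformBall.norm_secondForm_le (h : UniformBall E r) (hx : x ∈ frontier E)
    (hdiff : DifferentiableWithinAt ℝ (normal E) (frontier E) x)
    (hτ : inner ℝ τ (normal E x) = 0) : ‖secondForm E x τ‖ ≤ r⁻¹ * ‖τ‖ := by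
  rw [secondForm_of_inner_eq_zero hτ, le_inv_mul_iff₀ h.1]
  exact h.mul_norm_fderivWithin_normal_le hx hdiff hτ

theorem UniformBall.abs_meanCurv_le (h : UniformBall E r) (hx : x ∈ frontier E)
    (hdiff : DifferentiableWithinAt ℝ (normal E) (frontier E) x) :
    |meanCurv E x| ≤ n * r⁻¹ :=
  abs_trace_le_of_norm_apply_le (h.norm_normal hx) (secondForm_normal (h.norm_normal hx))
    fun _ => h.norm_secondForm_le hx hdiff

theorem UniformBall.frobenius_secondForm_le (h : UniformBall E r) (hx : x ∈ frontier E)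
    (hdiff : DifferentiableWithinAt ℝ (normal E) (frontier E) x) :
    frobenius (secondForm E x) ≤ √n * r⁻¹ :=
  frobenius_le_of_norm_apply_le (h.norm_normal hx) (secondForm_normal (h.norm_normal hx))
    (inv_nonneg.2 h.1.le) fun _ => h.norm_secondForm_le hx hdiff

end Curvature

end BallCond

theorem lemma4_general (n : ℕ) (E : Set (BallCond.Space n))
    (hbdd : BddAbove {r : ℝ | BallCond.UniformBall E r})
    (hball : ∃ r : ℝ, BallCond.UniformBall E r) :
    (∀ x ∈ frontier E, BallCond.IsOuterUnitNormal E x (BallCond.normal E x)) ∧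
    IsLUB {r : ℝ | BallCond.UniformBall E r} (BallCond.maxRadius E) ∧
    IsLUB (BallCond.diffRadii E) (BallCond.maxRadius E) ∧
    IsLUB (BallCond.twoPointValues E) (BallCond.twoPointNorm E) ∧
    2 * BallCond.twoPointNorm E = 1 / BallCond.maxRadius E ∧
    (∀ x ∈ frontier E, ∀ y ∈ frontier E, x ≠ y →
      ‖BallCond.normal E x - BallCond.normal E y‖ / ‖x - y‖ ≤ 2 * BallCond.twoPointNorm E) ∧
    (BallCond.IsRegular 2 E → ∀ x ∈ frontier E,
      DifferentiableWithinAt ℝ (BallCond.normal E) (frontier E) x ∧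
      |BallCond.meanCurv E x| ≤ 2 * n * BallCond.twoPointNorm E ∧
      BallCond.frobenius (BallCond.secondForm E x) ≤ 2 * n * BallCond.twoPointNorm E) := by
  obtain ⟨r₀, h₀⟩ := hball
  have hmax := h₀.isGreatest_maxRadius hbdd
  have hU : BallCond.UniformBall E (BallCond.maxRadius E) := hmax.1
  have hS : 2 * BallCond.twoPointNorm E = (BallCond.maxRadius E)⁻¹ := by
    rw [h₀.maxRadius_eq hbdd, inv_inv]
  refine ⟨fun x => hU.isOuterUnitNormal, hmax.isLUB, (BallCond.isGreatest_diffRadii hmax).isLUB,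
    h₀.isLUB_twoPointNorm hbdd, by rw [hS, one_div], fun x hx y hy hxy => ?_, fun hreg x hx => ?_⟩
  · rw [hS, div_le_iff₀ (norm_sub_pos_iff.2 hxy), le_inv_mul_iff₀ hU.1]
    exact hU.mul_norm_normal_sub_le hx hy
  · have hdiff := hU.differentiableWithinAt_normal hreg hx
    rw [mul_right_comm, hS, mul_comm]
    refine ⟨hdiff, hU.abs_meanCurv_le hx hdiff, (hU.frobenius_secondForm_le hx hdiff).trans ?_⟩
    have hn : √(n : ℝ) ≤ n := Real.sqrt_le_iff.2
      ⟨n.cast_nonneg, by exact_mod_cast Nat.le_self_pow two_ne_zero n⟩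
    exact mul_le_mul_of_nonneg_right hn (inv_nonneg.2 hU.1.le)

theorem lemma4 (n : ℕ) (E : Set (BallCond.Space n)) (hbdd : Bornology.IsBounded E)
    (hne : E.Nonempty) (hball : ∃ r : ℝ, BallCond.UniformBall E r) :
    -- the normal field, the radius and the supremum norm are well defined
    (∀ x ∈ frontier E, BallCond.IsOuterUnitNormal E x (BallCond.normal E x)) ∧
    IsLUB {r : ℝ | BallCond.UniformBall E r} (BallCond.maxRadius E) ∧
    IsLUB (BallCond.diffRadii E) (BallCond.maxRadius E) ∧
    IsLUB (BallCond.twoPointValues E) (BallCond.twoPointNorm E) ∧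
    -- the identity and the Lipschitz estimate for the normal
    2 * BallCond.twoPointNorm E = 1 / BallCond.maxRadius E ∧
    (∀ x ∈ frontier E, ∀ y ∈ frontier E, x ≠ y →
      ‖BallCond.normal E x - BallCond.normal E y‖ / ‖x - y‖ ≤ 2 * BallCond.twoPointNorm E) ∧
    -- the curvature bounds for sets of class C^2
    (BallCond.IsRegular 2 E → ∀ x ∈ frontier E,
      DifferentiableWithinAt ℝ (BallCond.normal E) (frontier E) x ∧
      |BallCond.meanCurv E x| ≤ 2 * n * BallCond.twoPointNorm E ∧
      BallCond.frobenius (BallCond.secondForm E x) ≤ 2 * n * BallCond.twoPointNorm E) :=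
  lemma4_general n E (BallCond.bddAbove_uniformBall hbdd hne) hball
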